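/- Let $M\in\mathbb{N}$, let $(x_m,y_m)\in\mathbb{R}^2$, $1\le m\le M$, be data points with $x_1<\dots<x_M$, let $E:\mathbb{R}\times\mathbb{R}\to\mathbb{R}$ be such that $E(\cdot,y)$ is strictly convex and coercive for every $y$, and let $\lambda>0$, $\bar L>0$. For $f:\mathbb{R}\to\mathbb{R}$ put $L(f)=\sup_{s\ne t}\frac{|f(s)-f(t)|}{|s-t|}$ and ${\rm TV}^{(2)}(f)=\sup\{\int_{\mathbb{R}} f\varphi'' : \varphi\in C_c^\infty(\mathbb{R}),\ \|\varphi\|_\infty=1\}$, and let ${\rm BV}^{(2)}(\mathbb{R})$ be the space of functions (identified with their continuous representatives) with ${\rm TV}^{(2)}(f)<\infty$. Consider the problem $$(\mathrm{P})\qquad \min_{f\in{\rm BV}^{(2)}(\mathbb{R})}\ \sum_{m=1}^M E(f(x_m),y_m)+\lambda\,{\rm TV}^{(2)}(f)\quad\text{s.t. } L(f)\le\bar L .$$ For a parameter vector $\theta=(K,\mathbf v,\mathbf w,\mathbf b,\mathbf c)$ with $K\in\mathbb{N}$ (also variable), $\mathbf v,\mathbf w,\mathbf b\in\mathbb{R}^K$,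 $\mathbf c=(c_0,c_1)\in\mathbb{R}^2$, let $f_\theta(x)=c_0+c_1x+\sum_{k=1}^K v_k\max(w_kx-b_k,0)$, and consider the training problem $$(\mathrm{NN})\qquad \min_{\theta}\ \sum_{m=1}^M E(f_\theta(x_m),y_m)+\lambda\sum_{k=1}^K\frac{|v_k|^2+|w_k|^2}{2}\quad\text{s.t. } L(f_\theta)\le\bar L .$$ A function is CPWL if it is continuous and piecewise linear with finitely many knots in each bounded interval. Then: 1. If $\theta^*$ is a solution of $(\mathrm{NN})$, then $f_{\theta^*}$ is a solution of $(\mathrm{P})$ and is CPWL with finitely many linear regions; moreover $|v_k^*|=|w_k^*|$ for all $k=1,\dots,K^*$. 2. For every CPWL solution $f$ of $(\mathrm{P})$ there is a solution $\theta^*$ of $(\mathrm{NN})$ with $f=f_{\theta^*}$. -/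

import Mathlib

open Filter Set MeasureTheory
open scoped ENNReal ContDiff

namespace LipReLU

noncomputable section

/-- Test functions `φ ∈ 𝓓(ℝ)` (smooth, compactly supported) whose supremum norm equals `1`.
For a continuous function the supremum norm is the `L_∞` norm. -/
def IsUnitTestFunction (φ : ℝ → ℝ) : Prop :=
  ContDiff ℝ ∞ φ ∧ HasCompactSupport φ ∧ (⨆ x : ℝ, |φ x|) = 1

/-- The second-order total variation `TV⁽²⁾(f) = sup ∫ f φ''` over the test functions `φ` with
`‖φ‖_∞ = 1`, as an element of `[0, ∞]`. (The admissible `φ` are stable under `φ ↦ -φ`, so cutting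
the integrals off at `0` does not change the supremum.) -/
def TV2 (f : ℝ → ℝ) : ℝ≥0∞ :=
  ⨆ (φ : ℝ → ℝ) (_ : IsUnitTestFunction φ), ENNReal.ofReal (∫ x, f x * iteratedDeriv 2 φ x)

/-- `BV⁽²⁾(ℝ)`: the functions with finite second-order total variation. Every distribution with
finite second-order total variation is represented by exactly one continuous function, and point
values of an element of `BV⁽²⁾(ℝ)` are those of this representative. -/
def BV2 : Set (ℝ → ℝ) := {f | Continuous f ∧ TV2 f < ⊤}

/-- The Lipschitz constant `L(f) = sup_{x₁ ≠ x₂} |f x₁ - f x₂| / |x₁ - x₂|`, in `[0, ∞]`. -/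
def lipConst (f : ℝ → ℝ) : ℝ≥0∞ :=
  ⨆ (x₁ : ℝ) (x₂ : ℝ) (_ : x₁ ≠ x₂), ENNReal.ofReal (|f x₁ - f x₂| / |x₁ - x₂|)

/-- `f` is continuous, and affine on every open interval that contains no point of `S`. -/
def IsCPWLWithKnots (f : ℝ → ℝ) (S : Set ℝ) : Prop :=
  Continuous f ∧ ∀ a b : ℝ, a < b → Disjoint (Ioo a b) S →
    ∃ p q : ℝ, ∀ t ∈ Ioo a b, f t = p * t + q

/-- Continuous piecewise-linear functions on `ℝ`: the knots form a locally finite set (finitely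
many in every bounded interval; infinitely many knots in total are allowed). -/
def IsCPWL (f : ℝ → ℝ) : Prop :=
  ∃ S : Set ℝ, (∀ a b : ℝ, (S ∩ Icc a b).Finite) ∧ IsCPWLWithKnots f S

/-- CPWL functions with finitely many linear regions. -/
def IsFiniteCPWL (f : ℝ → ℝ) : Prop :=
  ∃ S : Set ℝ, S.Finite ∧ IsCPWLWithKnots f S

/-- The solution set of the problem: minimize `∑ₘ E (f xₘ) yₘ + lam * TV⁽²⁾(f)` over
`f ∈ BV⁽²⁾(ℝ)` subject to `L(f) ≤ Lbar`. On `BV⁽²⁾(ℝ)` the value `TV⁽²⁾(f)` is finite. -/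
def Vhyb {M : ℕ} (E : ℝ → ℝ → ℝ) (x y : Fin M → ℝ) (lam Lbar : ℝ) : Set (ℝ → ℝ) :=
  {f | (f ∈ BV2 ∧ lipConst f ≤ ENNReal.ofReal Lbar) ∧
    ∀ g : ℝ → ℝ, g ∈ BV2 → lipConst g ≤ ENNReal.ofReal Lbar →
      ∑ m, E (f (x m)) (y m) + lam * (TV2 f).toReal ≤
        ∑ m, E (g (x m)) (y m) + lam * (TV2 g).toReal}

/-- Parameter vectors `θ = (K, v, w, b, c)` of two-layer univariate ReLU networks with a skip
connection. The width `K` is a part of the parameter vector. -/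
structure Params where
  /-- width -/
  K : ℕ
  /-- weights of the second layer -/
  v : Fin K → ℝ
  /-- weights of the first layer -/
  w : Fin K → ℝ
  /-- biases of the first layer -/
  b : Fin K → ℝ
  /-- bias of the second layer -/
  c₀ : ℝ
  /-- weight of the skip connection -/
  c₁ : ℝ

/-- The rectified linear unit. -/
def relu (t : ℝ) : ℝ := max t 0

/-- The network `f_θ(x) = c₀ + c₁ x + ∑ₖ vₖ ReLU(wₖ x - bₖ)`. -/
def Params.net (θ : Params) (t : ℝ) : ℝ :=
  θ.c₀ + θ.c₁ * t + ∑ k, θ.v k * relu (θ.w k * t - θ.b k)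

/-- The weight-decay term `R(θ) = ∑ₖ (|vₖ|² + |wₖ|²) / 2`. -/
def Params.weightDecay (θ : Params) : ℝ :=
  ∑ k, (|θ.v k| ^ 2 + |θ.w k| ^ 2) / 2

/-- The solution set of the training problem: minimize `∑ₘ E (f_θ xₘ) yₘ + lam * R(θ)` over all
parameter vectors `θ` (of all widths) subject to `L(f_θ) ≤ Lbar`. -/
def VNN {M : ℕ} (E : ℝ → ℝ → ℝ) (x y : Fin M → ℝ) (lam Lbar : ℝ) : Set Params :=
  {θ | lipConst θ.net ≤ ENNReal.ofReal Lbar ∧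
    ∀ η : Params, lipConst η.net ≤ ENNReal.ofReal Lbar →
      ∑ m, E (θ.net (x m)) (y m) + lam * θ.weightDecay ≤
        ∑ m, E (η.net (x m)) (y m) + lam * η.weightDecay}

end

end LipReLU

namespace LipReLU

lemma relu_nonneg (t : ℝ) : 0 ≤ relu t := le_max_right _ _

lemma relu_of_nonneg {t : ℝ} (h : 0 ≤ t) : relu t = t := max_eq_left h

lemma relu_of_nonpos {t : ℝ} (h : t ≤ 0) : relu t = 0 := max_eq_right h

lemma relu_mul {a : ℝ} (ha : 0 ≤ a) (t : ℝ) : relu (a * t) = a * relu t := by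
  rw [relu, relu, mul_max_of_nonneg _ _ ha, mul_zero]

lemma continuous_relu : Continuous relu := continuous_id.max continuous_const

lemma relu_neg (t : ℝ) : relu (-t) = relu t - t := by
  rcases le_total 0 t with h | h
  · rw [relu_of_nonneg h, relu_of_nonpos (by linarith)]; ring
  · rw [relu_of_nonpos h, relu_of_nonneg (by linarith)]; ring

/-- A ReLU unit is a positive multiple of a translated ReLU, up to an affine function. -/
lemma relu_affine (w b : ℝ) : ∃ p r : ℝ, ∀ t,
    relu (w * t - b) = |w| * relu (t - b / w) + (p * t + r) := by
  rcases lt_trichotomy w 0 with hw | rfl | hw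
  · refine ⟨w, -b, fun t => ?_⟩
    have hw' : w ≠ 0 := hw.ne
    have : w * t - b = (-w) * (-(t - b / w)) := by field_simp
    rw [this, relu_mul (by linarith), relu_neg, abs_of_neg hw]
    linear_combination -div_mul_cancel₀ b hw'
  · exact ⟨0, relu (-b), fun t => by simp⟩
  · refine ⟨0, 0, fun t => ?_⟩
    have : w * t - b = w * (t - b / w) := by field_simp
    rw [this, relu_mul hw.le, abs_of_pos hw]
    ring

lemma lipConst_le_iff {f : ℝ → ℝ} {L : ℝ} (hL : 0 ≤ L) :
    lipConst f ≤ ENNReal.ofReal L ↔ ∀ s t, |f s - f t| ≤ L * |s - t| := by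
  simp only [lipConst, iSup_le_iff]
  refine forall₂_congr fun s t => ?_
  constructor
  · intro h
    rcases eq_or_ne s t with rfl | hst
    · simp
    · have := (ENNReal.ofReal_le_ofReal_iff hL).1 (h hst)
      rwa [div_le_iff₀ (abs_pos.2 (sub_ne_zero.2 hst))] at this
  · intro h hst
    apply ENNReal.ofReal_le_ofReal
    rwa [div_le_iff₀ (abs_pos.2 (sub_ne_zero.2 hst))]

/-- The slopes of the broken line through the points `(q i, z i)`. -/
noncomputable def divDiff (q z : ℕ → ℝ) (i : ℕ) : ℝ := (z (i + 1) - z i) / (q (i + 1) - q i)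

/-- The broken line through `(q i, z i)` for `i ≤ n + 1`, extended affinely. -/
noncomputable def interp (q z : ℕ → ℝ) (n : ℕ) (t : ℝ) : ℝ :=
  z 0 + divDiff q z 0 * (t - q 0) +
    ∑ i ∈ Finset.range n, (divDiff q z (i + 1) - divDiff q z i) * relu (t - q (i + 1))

/-- The total variation of the slopes of the broken line. -/
noncomputable def slopeVar (q z : ℕ → ℝ) (n : ℕ) : ℝ :=
  ∑ i ∈ Finset.range n, |divDiff q z (i + 1) - divDiff q z i|

section Interp

variable {q z : ℕ → ℝ}

lemma divDiff_mul (hq : StrictMono q) (z : ℕ → ℝ) (i : ℕ) :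
    divDiff q z i * (q (i + 1) - q i) = z (i + 1) - z i :=
  div_mul_cancel₀ _ (sub_ne_zero.2 (hq (Nat.lt_succ_self i)).ne')

lemma interp_zero (t : ℝ) : interp q z 0 t = z 0 + divDiff q z 0 * (t - q 0) := by
  simp [interp]

lemma interp_succ (n : ℕ) (t : ℝ) : interp q z (n + 1) t =
    interp q z n t + (divDiff q z (n + 1) - divDiff q z n) * relu (t - q (n + 1)) := by
  simp [interp, Finset.sum_range_succ, add_assoc]

lemma interp_succ_of_le {n : ℕ} {t : ℝ} (ht : t ≤ q (n + 1)) :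
    interp q z (n + 1) t = interp q z n t := by
  rw [interp_succ, relu_of_nonpos (by linarith)]; ring

lemma interp_of_le (hq : StrictMono q) {k n : ℕ} (hkn : k ≤ n) {t : ℝ} (ht : t ≤ q (k + 1)) :
    interp q z n t = interp q z k t := by
  induction n, hkn using Nat.le_induction with
  | base => rfl
  | succ n hn ih => rw [interp_succ_of_le (ht.trans (hq.monotone (by omega))), ih]

lemma interp_of_ge (hq : StrictMono q) {n : ℕ} {t : ℝ} (ht : q n ≤ t) :
    interp q z n t = z n + divDiff q z n * (t - q n) := by
  induction n with
  | zero => exact interp_zero t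
  | succ n ih =>
    rw [interp_succ, relu_of_nonneg (by linarith), ih ((hq (Nat.lt_succ_self n)).le.trans ht)]
    linear_combination divDiff_mul hq z n

lemma interp_of_mem_Icc (hq : StrictMono q) {k n : ℕ} (hkn : k ≤ n) {t : ℝ}
    (ht : t ∈ Icc (q k) (q (k + 1))) :
    interp q z n t = z k + divDiff q z k * (t - q k) := by
  rw [interp_of_le hq hkn ht.2, interp_of_ge hq ht.1]

lemma interp_node (hq : StrictMono q) {k n : ℕ} (hkn : k ≤ n + 1) : interp q z n (q k) = z k := by
  rcases hkn.lt_or_eq with h | rfl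
  · rw [interp_of_mem_Icc hq (Nat.lt_succ_iff.1 h) ⟨le_rfl, (hq (Nat.lt_succ_self k)).le⟩]
    ring
  · rw [interp_of_ge hq (hq (Nat.lt_succ_self n)).le]
    linear_combination divDiff_mul hq z n

lemma abs_sub_le_of_glue {h : ℝ → ℝ} {L c : ℝ}
    (h₁ : ∀ s t, s ≤ t → t ≤ c → |h s - h t| ≤ L * (t - s))
    (h₂ : ∀ s t, c ≤ s → s ≤ t → |h s - h t| ≤ L * (t - s)) (s t : ℝ) (hst : s ≤ t) :
    |h s - h t| ≤ L * (t - s) := by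
  rcases le_total t c with htc | htc
  · exact h₁ s t hst htc
  · rcases le_total c s with hcs | hcs
    · exact h₂ s t hcs hst
    · have := abs_sub_le (h s) (h c) (h t)
      have := h₁ s c hcs le_rfl
      have := h₂ c t le_rfl htc
      linarith

lemma interp_lipschitz (hq : StrictMono q) {L : ℝ} {n : ℕ}
    (hL : ∀ i ≤ n, |divDiff q z i| ≤ L) (s t : ℝ) :
    |interp q z n s - interp q z n t| ≤ L * |s - t| := by
  have key : ∀ s t, s ≤ t → |interp q z n s - interp q z n t| ≤ L * (t - s) := by
    induction n with
    | zero =>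
      intro s t hst
      rw [interp_zero, interp_zero]
      have : z 0 + divDiff q z 0 * (s - q 0) - (z 0 + divDiff q z 0 * (t - q 0)) =
        divDiff q z 0 * (s - t) := by ring
      rw [this, abs_mul, abs_sub_comm s t, abs_of_nonneg (sub_nonneg.2 hst)]
      exact mul_le_mul_of_nonneg_right (hL 0 le_rfl) (sub_nonneg.2 hst)
    | succ n ih =>
      refine abs_sub_le_of_glue (c := q (n + 1)) ?_ ?_
      · intro s t hst htc
        rw [interp_succ_of_le htc, interp_succ_of_le (hst.trans htc)]
        exact ih (fun i hi => hL i (by omega)) s t hst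
      · intro s t hcs hst
        rw [interp_of_ge hq hcs, interp_of_ge hq (hcs.trans hst)]
        have : z (n + 1) + divDiff q z (n + 1) * (s - q (n + 1)) -
            (z (n + 1) + divDiff q z (n + 1) * (t - q (n + 1))) =
          divDiff q z (n + 1) * (s - t) := by ring
        rw [this, abs_mul, abs_sub_comm s t, abs_of_nonneg (sub_nonneg.2 hst)]
        exact mul_le_mul_of_nonneg_right (hL _ le_rfl) (sub_nonneg.2 hst)
  rcases le_total s t with h | h
  · rw [abs_sub_comm s t, abs_of_nonneg (sub_nonneg.2 h)]; exact key s t h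
  · rw [abs_sub_comm (interp q z n s), abs_of_nonneg (sub_nonneg.2 h)]; exact key t s h

lemma abs_divDiff_le (hq : StrictMono q) {g : ℝ → ℝ} {L : ℝ}
    (hg : ∀ s t, |g s - g t| ≤ L * |s - t|) (i : ℕ) : |divDiff q (g ∘ q) i| ≤ L := by
  have h := hq (Nat.lt_succ_self i)
  rw [divDiff, abs_div, div_le_iff₀ (abs_pos.2 (sub_ne_zero.2 h.ne'))]
  exact hg _ _

lemma abs_affine_le {a b α β t : ℝ} (hab : a < b) (ht : t ∈ Icc a b) (hα : |α| ≤ 1)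
    (hβ : |β| ≤ 1) : |α + (β - α) / (b - a) * (t - a)| ≤ 1 := by
  have hba : 0 < b - a := sub_pos.2 hab
  set u := (t - a) / (b - a) with hu
  have hu0 : 0 ≤ u := div_nonneg (sub_nonneg.2 ht.1) hba.le
  have hu1 : u ≤ 1 := (div_le_one hba).2 (by linarith [ht.2])
  have : α + (β - α) / (b - a) * (t - a) = (1 - u) * α + u * β := by rw [hu]; field_simp; ring
  rw [this]
  rw [abs_le] at *
  constructor <;> nlinarith

lemma abs_interp_le_one (hq : StrictMono q) (hz : ∀ i, |z i| ≤ 1) (h0 : z 0 = 0) (h1 : z 1 = 0)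
    {n : ℕ} {t : ℝ} (ht : t ≤ q (n + 1)) : |interp q z n t| ≤ 1 := by
  induction n generalizing t with
  | zero => simp [interp_zero, divDiff, h0, h1]
  | succ n ih =>
    rcases le_total t (q (n + 1)) with h | h
    · rw [interp_succ_of_le h]; exact ih h
    · rw [interp_of_ge hq h]
      exact abs_affine_le (hq (Nat.lt_succ_self _)) ⟨h, ht⟩ (hz _) (hz _)

lemma interp_eq_zero_of_ge (hq : StrictMono q) {n : ℕ} (h0 : z n = 0) (h1 : z (n + 1) = 0)
    {t : ℝ} (ht : q n ≤ t) : interp q z n t = 0 := by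
  rw [interp_of_ge hq ht]; simp [divDiff, h0, h1]

/-- Summation by parts for second differences. -/
lemma sum_jump_mul_comm (hq : StrictMono q) (z g : ℕ → ℝ) (n : ℕ) :
    ∑ i ∈ Finset.range n, (divDiff q z (i + 1) - divDiff q z i) * g (i + 1) =
      ∑ i ∈ Finset.range n, z (i + 1) * (divDiff q g (i + 1) - divDiff q g i) +
        ((divDiff q z n * g n - z n * divDiff q g n) -
          (divDiff q z 0 * g 0 - z 0 * divDiff q g 0)) := by
  induction n with
  | zero => simp
  | succ n ih =>
    rw [Finset.sum_range_succ, Finset.sum_range_succ, ih]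
    linear_combination divDiff q z n * divDiff_mul hq g n - divDiff q g n * divDiff_mul hq z n

end Interp

/-- The broken line as a network with balanced weights. -/
noncomputable def interpParams (q z : ℕ → ℝ) (n : ℕ) : Params where
  K := n
  v i := SignType.sign (divDiff q z (i + 1) - divDiff q z i) *
    √|divDiff q z (i + 1) - divDiff q z i|
  w i := √|divDiff q z (i + 1) - divDiff q z i|
  b i := √|divDiff q z (i + 1) - divDiff q z i| * q (i + 1)
  c₀ := z 0 - divDiff q z 0 * q 0
  c₁ := divDiff q z 0

lemma interpParams_net (q z : ℕ → ℝ) (n : ℕ) : (interpParams q z n).net = interp q z n := by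
  funext t
  simp only [Params.net, interpParams, interp]
  rw [Finset.sum_range (fun i => (divDiff q z (i + 1) - divDiff q z i) * relu (t - q (i + 1)))]
  congr 1
  · ring
  · refine Finset.sum_congr rfl fun i _ => ?_
    rw [← mul_sub, relu_mul (Real.sqrt_nonneg _), mul_assoc, ← mul_assoc (√_),
      Real.mul_self_sqrt (abs_nonneg _), ← mul_assoc, sign_mul_abs]

lemma interpParams_weightDecay (q z : ℕ → ℝ) (n : ℕ) :
    (interpParams q z n).weightDecay = slopeVar q z n := by
  simp only [Params.weightDecay, interpParams, slopeVar]
  rw [Finset.sum_range (fun i => |divDiff q z (i + 1) - divDiff q z i|)]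
  refine Finset.sum_congr rfl fun i _ => ?_
  set d := divDiff q z (i + 1) - divDiff q z i
  rw [sq_abs, sq_abs, mul_pow, Real.sq_sqrt (abs_nonneg _)]
  rcases lt_trichotomy d 0 with h | h | h
  · simp [h]
  · simp [h]
  · simp [h]

/-- A strictly increasing sequence can be continued by a prescribed value. -/
lemma exists_strictMono_extend {q : ℕ → ℝ} (hq : StrictMono q) {n : ℕ} {t : ℝ} (ht : q n < t) :
    ∃ q' : ℕ → ℝ, StrictMono q' ∧ (∀ i ≤ n, q' i = q i) ∧ q' (n + 1) = t := by
  refine ⟨fun i => if i ≤ n then q i else t + ((i : ℝ) - (n + 1)), ?_, fun i hi => if_pos hi,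
    by simp⟩
  refine strictMono_nat_of_lt_succ fun i => ?_
  split_ifs with h h' h'
  · exact hq (Nat.lt_succ_self i)
  · obtain rfl : i = n := by omega
    simpa using ht
  · omega
  · push_cast; linarith

/-- Every finite set of reals is enumerated by an initial segment of a strictly increasing
sequence. -/
lemma exists_strictMono_enum (P : Finset ℝ) :
    ∃ q : ℕ → ℝ, StrictMono q ∧ (Finset.range P.card).image q = P := by
  classical
  induction P using Finset.induction_on_max with
  | empty => exact ⟨fun n => n, Nat.strictMono_cast, by simp⟩
  | insert a s hs ih =>
    obtain ⟨q, hq, hqs⟩ := ih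
    obtain ⟨q', hq', hqq, hqa⟩ : ∃ q' : ℕ → ℝ, StrictMono q' ∧ (∀ i < s.card, q' i = q i) ∧
        q' s.card = a := by
      rcases h : s.card with _ | n
      · exact ⟨fun i => a + i, fun i j hij => by simpa using hij, by simp, by simp⟩
      · have hn : q n < a := hs _ (hqs ▸ Finset.mem_image_of_mem q (Finset.mem_range.2 (by omega)))
        obtain ⟨q', h1, h2, h3⟩ := exists_strictMono_extend hq hn
        exact ⟨q', h1, fun i hi => h2 i (by omega), h3⟩
    refine ⟨q', hq', ?_⟩
    rw [Finset.card_insert_of_notMem (fun h => (hs a h).false), Finset.range_add_one,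
      Finset.image_insert, hqa]
    congr 1
    conv_rhs => rw [← hqs]
    exact Finset.image_congr fun i hi => hqq i (Finset.mem_range.1 hi)

/-- The pairing with `φ''` is bounded by `TV2` for every test function. -/
lemma integral_le_mul_TV2 {g : ℝ → ℝ} (hg : TV2 g < ⊤) {φ : ℝ → ℝ} (hφ : ContDiff ℝ ∞ φ)
    (hc : HasCompactSupport φ) {C : ℝ} (hC : ∀ t, |φ t| ≤ C) :
    ∫ t, g t * iteratedDeriv 2 φ t ≤ C * (TV2 g).toReal := by
  have hbdd : BddAbove (range fun t => |φ t|) := ⟨C, by rintro _ ⟨t, rfl⟩; exact hC t⟩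
  set a := ⨆ t, |φ t| with ha
  have haC : a ≤ C := ciSup_le hC
  have hle : ∀ t, |φ t| ≤ a := le_ciSup hbdd
  have ha0 : 0 ≤ a := (abs_nonneg _).trans (hle 0)
  rcases ha0.eq_or_lt with h | h
  · have : φ = fun _ => 0 := by
      funext t
      have := hle t
      rw [← h] at this
      exact abs_nonpos_iff.1 this
    simp only [this, iteratedDeriv_const]
    simpa using mul_nonneg (ha0.trans haC) ENNReal.toReal_nonneg
  · have hu : IsUnitTestFunction (fun t => a⁻¹ * φ t) := by
      refine ⟨contDiff_const.mul hφ, hc.mul_left, ?_⟩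
      simp_rw [abs_mul, abs_of_pos (inv_pos.2 h)]
      rw [← Real.mul_iSup_of_nonneg (inv_nonneg.2 ha0), ← ha, inv_mul_cancel₀ h.ne']
    have h1 : ENNReal.ofReal (∫ t, g t * iteratedDeriv 2 (fun t => a⁻¹ * φ t) t) ≤ TV2 g :=
      le_iSup₂_of_le _ hu le_rfl
    have h2 := (ENNReal.ofReal_le_iff_le_toReal hg.ne).1 h1
    have h3 : ∀ t, g t * iteratedDeriv 2 (fun t => a⁻¹ * φ t) t =
        a⁻¹ * (g t * iteratedDeriv 2 φ t) := fun t => by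
      rw [iteratedDeriv_const_mul_field]; ring
    simp_rw [h3] at h2
    rw [integral_const_mul, inv_mul_le_iff₀ h] at h2
    exact h2.trans (mul_le_mul_of_nonneg_right haC ENNReal.toReal_nonneg)

section Test

variable {φ : ℝ → ℝ}

lemma hasDerivAt_affine_wronskian (hφ : ContDiff ℝ ∞ φ) (p r t : ℝ) :
    HasDerivAt (fun t => (p * t + r) * deriv φ t - p * φ t)
      ((p * t + r) * iteratedDeriv 2 φ t) t := by
  have h1 : HasDerivAt φ (deriv φ t) t :=
    (hφ.differentiable (by simp)).differentiableAt.hasDerivAt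
  have h2 : HasDerivAt (deriv φ) (iteratedDeriv 2 φ t) t := by
    rw [iteratedDeriv_succ, iteratedDeriv_one]
    exact (((contDiff_infty_iff_deriv.1 hφ).2).differentiable (by simp)).differentiableAt.hasDerivAt
  have h3 : HasDerivAt (fun t => p * t + r) p t := by
    simpa using ((hasDerivAt_id t).const_mul p).add_const r
  refine ((h3.fun_mul h2).fun_sub (h1.const_mul p)).congr_deriv ?_
  ring

lemma contDiff_affine_wronskian (hφ : ContDiff ℝ ∞ φ) (p r : ℝ) :
    ContDiff ℝ 1 (fun t => (p * t + r) * deriv φ t - p * φ t) := by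
  have h2 : ContDiff ℝ 1 (deriv φ) := ((contDiff_infty_iff_deriv.1 hφ).2).of_le (by simp)
  have h1 : ContDiff ℝ 1 φ := hφ.of_le (by simp)
  fun_prop

lemma hasCompactSupport_affine_wronskian (hc : HasCompactSupport φ) (p r : ℝ) :
    HasCompactSupport (fun t => (p * t + r) * deriv φ t - p * φ t) :=
  (hc.deriv.mul_left (f := fun t => p * t + r)).sub (hc.mul_left (f := fun _ => p))

lemma continuous_iteratedDeriv_two (hφ : ContDiff ℝ ∞ φ) : Continuous (iteratedDeriv 2 φ) := by
  rw [iteratedDeriv_succ, iteratedDeriv_one]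
  exact (contDiff_infty_iff_deriv.1 (contDiff_infty_iff_deriv.1 hφ).2).2.continuous

lemma hasCompactSupport_iteratedDeriv_two (hc : HasCompactSupport φ) :
    HasCompactSupport (iteratedDeriv 2 φ) := by
  rw [iteratedDeriv_succ, iteratedDeriv_one]; exact hc.deriv.deriv

lemma integrable_mul_iteratedDeriv (hφ : ContDiff ℝ ∞ φ) (hc : HasCompactSupport φ) {g : ℝ → ℝ}
    (hg : Continuous g) : Integrable (fun t => g t * iteratedDeriv 2 φ t) :=
  (hg.mul (continuous_iteratedDeriv_two hφ)).integrable_of_hasCompactSupport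
    (hasCompactSupport_iteratedDeriv_two hc).mul_left

lemma integral_Ioi_affine_mul (hφ : ContDiff ℝ ∞ φ) (hc : HasCompactSupport φ) (p r a : ℝ) :
    ∫ t in Ioi a, (p * t + r) * iteratedDeriv 2 φ t = -((p * a + r) * deriv φ a - p * φ a) := by
  rw [← (hasCompactSupport_affine_wronskian hc p r).integral_Ioi_deriv_eq
    (contDiff_affine_wronskian hφ p r) a]
  exact integral_congr_ae (ae_of_all _ fun t => (hasDerivAt_affine_wronskian hφ p r t).deriv.symm)

lemma integral_Iic_affine_mul (hφ : ContDiff ℝ ∞ φ) (hc : HasCompactSupport φ) (p r a : ℝ) :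
    ∫ t in Iic a, (p * t + r) * iteratedDeriv 2 φ t = (p * a + r) * deriv φ a - p * φ a := by
  rw [← (hasCompactSupport_affine_wronskian hc p r).integral_Iic_deriv_eq
    (contDiff_affine_wronskian hφ p r) a]
  exact integral_congr_ae (ae_of_all _ fun t => (hasDerivAt_affine_wronskian hφ p r t).deriv.symm)

lemma integral_affine_mul (hφ : ContDiff ℝ ∞ φ) (hc : HasCompactSupport φ) (p r : ℝ) :
    ∫ t, (p * t + r) * iteratedDeriv 2 φ t = 0 := by
  have hi := integrable_mul_iteratedDeriv hφ hc (g := fun t => p * t + r) (by fun_prop)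
  rw [← intervalIntegral.integral_Iic_add_Ioi (b := 0) hi.integrableOn hi.integrableOn,
    integral_Iic_affine_mul hφ hc, integral_Ioi_affine_mul hφ hc, add_neg_cancel]

lemma integral_relu_mul (hφ : ContDiff ℝ ∞ φ) (hc : HasCompactSupport φ) (a : ℝ) :
    ∫ t, relu (t - a) * iteratedDeriv 2 φ t = φ a := by
  have hi := integrable_mul_iteratedDeriv hφ hc (g := fun t => relu (t - a))
    (continuous_relu.comp (by fun_prop))
  rw [← intervalIntegral.integral_Iic_add_Ioi (b := a) hi.integrableOn hi.integrableOn]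
  have h1 : ∫ t in Iic a, relu (t - a) * iteratedDeriv 2 φ t = 0 := by
    refine setIntegral_eq_zero_of_forall_eq_zero fun t ht => ?_
    rw [relu_of_nonpos (sub_nonpos.2 ht), zero_mul]
  have h2 : ∫ t in Ioi a, relu (t - a) * iteratedDeriv 2 φ t =
      ∫ t in Ioi a, (1 * t + -a) * iteratedDeriv 2 φ t := by
    refine setIntegral_congr_fun measurableSet_Ioi fun t ht => ?_
    rw [relu_of_nonneg (sub_nonneg.2 (le_of_lt ht))]
    ring
  rw [h1, h2, integral_Ioi_affine_mul hφ hc]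
  ring

lemma integral_unit_mul (hφ : ContDiff ℝ ∞ φ) (hc : HasCompactSupport φ) (w b : ℝ) :
    ∫ t, relu (w * t - b) * iteratedDeriv 2 φ t = |w| * φ (b / w) := by
  obtain ⟨p, r, h⟩ := relu_affine w b
  have h' : ∀ t, relu (w * t - b) * iteratedDeriv 2 φ t =
      |w| * (relu (t - b / w) * iteratedDeriv 2 φ t) + (p * t + r) * iteratedDeriv 2 φ t :=
    fun t => by rw [h]; ring
  simp_rw [h']
  rw [integral_add ((integrable_mul_iteratedDeriv hφ hc (g := fun t => relu (t - b / w))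
      (continuous_relu.comp (by fun_prop))).const_mul _)
    (integrable_mul_iteratedDeriv hφ hc (by fun_prop)), integral_const_mul,
    integral_relu_mul hφ hc, integral_affine_mul hφ hc, add_zero]

lemma integral_net_mul (hφ : ContDiff ℝ ∞ φ) (hc : HasCompactSupport φ) (θ : Params) :
    ∫ t, θ.net t * iteratedDeriv 2 φ t = ∑ k, θ.v k * (|θ.w k| * φ (θ.b k / θ.w k)) := by
  have h' : ∀ t, θ.net t * iteratedDeriv 2 φ t = (θ.c₁ * t + θ.c₀) * iteratedDeriv 2 φ t +
      ∑ k, θ.v k * (relu (θ.w k * t - θ.b k) * iteratedDeriv 2 φ t) := fun t => by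
    rw [Params.net, add_mul, Finset.sum_mul, add_comm θ.c₀]
    simp_rw [mul_assoc]
  have hi : ∀ k, Integrable fun t => θ.v k * (relu (θ.w k * t - θ.b k) * iteratedDeriv 2 φ t) :=
    fun k => (integrable_mul_iteratedDeriv hφ hc (continuous_relu.comp (by fun_prop))).const_mul _
  simp_rw [h']
  rw [integral_add (integrable_mul_iteratedDeriv hφ hc (by fun_prop))
    (integrable_finsetSum _ fun k _ => hi k), integral_affine_mul hφ hc, zero_add,
    integral_finsetSum _ fun k _ => hi k]
  simp_rw [integral_const_mul, integral_unit_mul hφ hc]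

end Test

lemma TV2_net_le (θ : Params) : TV2 θ.net ≤ ENNReal.ofReal (∑ k, |θ.v k| * |θ.w k|) := by
  refine iSup₂_le fun φ hφ => ENNReal.ofReal_le_ofReal ?_
  obtain ⟨hs, hc, h1⟩ := hφ
  rw [integral_net_mul hs hc]
  refine Finset.sum_le_sum fun k _ => ?_
  have hle : |φ (θ.b k / θ.w k)| ≤ 1 := by
    rw [← h1]
    obtain ⟨C, hC⟩ := hc.exists_bound_of_continuous hs.continuous
    exact le_ciSup (f := fun t => |φ t|) ⟨C, by rintro _ ⟨t, rfl⟩; exact hC t⟩ _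
  refine (le_abs_self _).trans ?_
  rw [abs_mul, abs_mul, abs_abs]
  refine mul_le_mul_of_nonneg_left ?_ (abs_nonneg _)
  exact mul_le_of_le_one_right (abs_nonneg _) hle

lemma sum_abs_mul_le_weightDecay (θ : Params) : ∑ k, |θ.v k| * |θ.w k| ≤ θ.weightDecay :=
  Finset.sum_le_sum fun k _ => by nlinarith [sq_nonneg (|θ.v k| - |θ.w k|)]

lemma TV2_net_toReal_le (θ : Params) : (TV2 θ.net).toReal ≤ θ.weightDecay :=
  (ENNReal.toReal_le_of_le_ofReal
    (Finset.sum_nonneg fun _ _ => mul_nonneg (abs_nonneg _) (abs_nonneg _))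
    (TV2_net_le θ)).trans (sum_abs_mul_le_weightDecay θ)

lemma continuous_net (θ : Params) : Continuous θ.net := by
  have := continuous_relu
  unfold Params.net
  fun_prop

lemma net_mem_BV2 (θ : Params) : θ.net ∈ BV2 :=
  ⟨continuous_net θ, (TV2_net_le θ).trans_lt ENNReal.ofReal_lt_top⟩

/-- A unit is affine on every interval that does not contain its knot. -/
lemma unit_affine_on (w b : ℝ) {l u : ℝ} (h : b / w ∉ Ioo l u) :
    ∃ p q : ℝ, ∀ t ∈ Ioo l u, relu (w * t - b) = p * t + q := by
  obtain ⟨p, r, hpr⟩ := relu_affine w b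
  rcases le_or_gt (b / w) l with hl | hl
  · refine ⟨|w| + p, r - |w| * (b / w), fun t ht => ?_⟩
    rw [hpr, relu_of_nonneg (by linarith [ht.1])]; ring
  · have hu : u ≤ b / w := not_lt.1 fun hu => h ⟨hl, hu⟩
    refine ⟨p, r, fun t ht => ?_⟩
    rw [hpr, relu_of_nonpos (by linarith [ht.2])]; ring

lemma isFiniteCPWL_net (θ : Params) : IsFiniteCPWL θ.net := by
  refine ⟨range fun k => θ.b k / θ.w k, finite_range _, continuous_net θ, fun l u _ hd => ?_⟩
  have h : ∀ k, ∃ p q : ℝ, ∀ t ∈ Ioo l u, relu (θ.w k * t - θ.b k) = p * t + q := fun k =>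
    unit_affine_on _ _ fun hk => disjoint_left.1 hd hk ⟨k, rfl⟩
  choose p q hpq using h
  refine ⟨θ.c₁ + ∑ k, θ.v k * p k, θ.c₀ + ∑ k, θ.v k * q k, fun t ht => ?_⟩
  simp only [Params.net, hpq _ t ht, mul_add, Finset.sum_add_distrib, add_mul, Finset.sum_mul,
    ← mul_assoc]
  ring

/-- A smooth approximation of the rectified linear unit. -/
lemma exists_smooth_relu {δ : ℝ} (hδ : 0 < δ) : ∃ R ρ : ℝ → ℝ, ContDiff ℝ ∞ R ∧
    iteratedDeriv 2 R = ρ ∧ Continuous ρ ∧ (∀ t, 0 ≤ ρ t) ∧ (∀ t, δ ≤ |t| → ρ t = 0) ∧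
    ∫ t, ρ t = 1 ∧ (∀ t ≤ -δ, R t = 0) ∧ (∃ c, ∀ t, δ ≤ t → R t = t + c) ∧
    ∀ t, |R t - relu t| ≤ 2 * δ := by
  let B : ContDiffBump (0 : ℝ) := ⟨δ / 2, δ, by linarith, by linarith⟩
  set ρ : ℝ → ℝ := B.normed volume with hρ
  have hρc : Continuous ρ := B.continuous_normed
  have hρs : ContDiff ℝ ∞ ρ := B.contDiff_normed
  have hρ0 : ∀ t, 0 ≤ ρ t := B.nonneg_normed
  have hρz : ∀ t, δ ≤ |t| → ρ t = 0 := fun t ht => by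
    have : t ∉ Function.support ρ := by
      rw [hρ, B.support_normed_eq]
      simpa [B, Real.dist_eq] using ht
    simpa using this
  have hρ1 : ∫ t, ρ t = 1 := B.integral_normed
  set G : ℝ → ℝ := fun t => ∫ s in (-δ)..t, ρ s with hG
  have hG' : ∀ t, HasDerivAt G (ρ t) t := fun t =>
    intervalIntegral.integral_hasDerivAt_right (hρc.intervalIntegrable _ _)
      (hρc.stronglyMeasurableAtFilter _ _) hρc.continuousAt
  have hGd : deriv G = ρ := funext fun t => (hG' t).deriv
  have hGs : ContDiff ℝ ∞ G := contDiff_infty_iff_deriv.2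
    ⟨fun t => (hG' t).differentiableAt, hGd ▸ hρs⟩
  have hGc : Continuous G := hGs.continuous
  set R : ℝ → ℝ := fun t => ∫ s in (-δ)..t, G s with hR
  have hR' : ∀ t, HasDerivAt R (G t) t := fun t =>
    intervalIntegral.integral_hasDerivAt_right (hGc.intervalIntegrable _ _)
      (hGc.stronglyMeasurableAtFilter _ _) hGc.continuousAt
  have hRd : deriv R = G := funext fun t => (hR' t).deriv
  have hRs : ContDiff ℝ ∞ R := contDiff_infty_iff_deriv.2
    ⟨fun t => (hR' t).differentiableAt, hRd ▸ hGs⟩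
  have hGm : Monotone G := monotone_of_deriv_nonneg (fun t => (hG' t).differentiableAt)
    fun t => by rw [hGd]; exact hρ0 t
  have hG0 : ∀ t ≤ -δ, G t = 0 := fun t ht => by
    rw [hG]
    simp only
    rw [intervalIntegral.integral_symm, intervalIntegral.integral_of_le ht,
      setIntegral_eq_zero_of_forall_eq_zero, neg_zero]
    intro s hs
    exact hρz s (by rw [abs_of_nonpos (by linarith [hs.2])]; linarith [hs.2])
  have hG1 : ∀ t, δ ≤ t → G t = 1 := fun t ht => by
    rw [hG, ← hρ1]
    simp only
    refine intervalIntegral.integral_eq_integral_of_support_subset fun s hs => ?_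
    have hlt : |s| < δ := not_le.1 fun h => hs (hρz s h)
    rw [abs_lt] at hlt
    exact ⟨hlt.1, hlt.2.le.trans ht⟩
  have hGnn : ∀ t, 0 ≤ G t := fun t => by
    rw [← hG0 (min t (-δ)) (min_le_right _ _)]; exact hGm (min_le_left _ _)
  have hGle : ∀ t, G t ≤ 1 := fun t => by
    rw [← hG1 (max t δ) (le_max_right _ _)]; exact hGm (le_max_left _ _)
  have hR0 : ∀ t ≤ -δ, R t = 0 := fun t ht => by
    rw [hR]
    simp only
    rw [intervalIntegral.integral_symm, intervalIntegral.integral_of_le ht,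
      setIntegral_eq_zero_of_forall_eq_zero, neg_zero]
    exact fun s hs => hG0 s hs.2
  have hRm : Monotone R := monotone_of_deriv_nonneg (fun t => (hR' t).differentiableAt)
    fun t => by rw [hRd]; exact hGnn t
  have hSm : Monotone fun t => t - R t := by
    refine monotone_of_deriv_nonneg (fun t => ((hasDerivAt_id' t).fun_sub (hR' t)).differentiableAt)
      fun t => ?_
    rw [((hasDerivAt_id' t).fun_sub (hR' t)).deriv]
    linarith [hGle t]
  have hR1 : ∀ t, δ ≤ t → R t = t + (R δ - δ) := fun t ht => by
    have h1 : (∫ s in (-δ)..δ, G s) + ∫ s in δ..t, G s = ∫ s in (-δ)..t, G s :=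
      intervalIntegral.integral_add_adjacent_intervals (hGc.intervalIntegrable _ _)
        (hGc.intervalIntegrable _ _)
    have h2 : ∫ s in δ..t, G s = ∫ s in δ..t, (1 : ℝ) :=
      intervalIntegral.integral_congr fun s hs => hG1 s (by rw [uIcc_of_le ht] at hs; exact hs.1)
    rw [h2, intervalIntegral.integral_const, smul_eq_mul, mul_one] at h1
    change R δ + (t - δ) = R t at h1
    linarith
  refine ⟨R, ρ, hRs, by rw [iteratedDeriv_succ, iteratedDeriv_one, hRd, hGd], hρc, hρ0, hρz, hρ1,
    hR0, ⟨_, hR1⟩, fun t => ?_⟩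
  have e0 : R (-δ) = 0 := hR0 _ le_rfl
  have e1 : -δ - R (-δ) ≤ δ - R δ := hSm (by linarith : -δ ≤ δ)
  have e2 : R (-δ) ≤ R δ := hRm (by linarith)
  rcases le_total t (-δ) with h | h
  · rw [hR0 t h, relu_of_nonpos (by linarith)]; simp; exact hδ.le
  rcases le_total δ t with h' | h'
  · rw [hR1 t h', relu_of_nonneg (by linarith), abs_le]; constructor <;> linarith
  · have e3 : R (-δ) ≤ R t := hRm h
    have e4 : R t ≤ R δ := hRm h'
    have e5 := relu_nonneg t
    have e6 : relu t ≤ δ := max_le h' hδ.le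
    rw [abs_le]; constructor <;> linarith

lemma abs_integral_mul_sub_le {g ρ : ℝ → ℝ} {a δ ε : ℝ} (hg : Continuous g) (hρ : Continuous ρ)
    (h0 : ∀ t, 0 ≤ ρ t) (hz : ∀ t, δ ≤ |t| → ρ t = 0) (h1 : ∫ t, ρ t = 1)
    (hgε : ∀ t, |t - a| < δ → |g t - g a| ≤ ε) :
    Integrable (fun t => g t * ρ (t - a)) ∧ |(∫ t, g t * ρ (t - a)) - g a| ≤ ε := by
  have hρa : Continuous fun t => ρ (t - a) := hρ.comp (by fun_prop)
  have hsupp : HasCompactSupport fun t => ρ (t - a) := by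
    refine HasCompactSupport.intro (isCompact_Icc (a := a - δ) (b := a + δ)) fun t ht => ?_
    refine hz _ (not_lt.1 fun h => ht ?_)
    rw [abs_lt] at h
    constructor <;> linarith
  have hi : Integrable (fun t => g t * ρ (t - a)) :=
    (hg.mul hρa).integrable_of_hasCompactSupport hsupp.mul_left
  have hi' : Integrable (fun t => ρ (t - a)) := hρa.integrable_of_hasCompactSupport hsupp
  refine ⟨hi, ?_⟩
  have h1' : ∫ t, ρ (t - a) = 1 := by rw [integral_sub_right_eq_self ρ a, h1]
  have e : (∫ t, g t * ρ (t - a)) - g a = ∫ t, (g t - g a) * ρ (t - a) := by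
    simp_rw [sub_mul]
    rw [integral_sub hi (hi'.const_mul _), integral_const_mul, h1', mul_one]
  rw [e]
  calc |∫ t, (g t - g a) * ρ (t - a)| ≤ ∫ t, ε * ρ (t - a) := by
        rw [← Real.norm_eq_abs]
        refine norm_integral_le_of_norm_le (hi'.const_mul ε) (ae_of_all _ fun t => ?_)
        rw [Real.norm_eq_abs, abs_mul, abs_of_nonneg (h0 _)]
        rcases lt_or_ge |t - a| δ with h | h
        · exact mul_le_mul_of_nonneg_right (hgε t h) (h0 _)
        · simp [hz _ h]
    _ = ε := by rw [integral_const_mul, h1', mul_one]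

lemma eventually_osc_le {g : ℝ → ℝ} (hg : Continuous g) {ε : ℝ} (hε : 0 < ε) (a : ℝ) :
    ∀ᶠ δ in nhdsWithin (0 : ℝ) (Ioi 0), ∀ t, |t - a| < δ → |g t - g a| ≤ ε := by
  obtain ⟨δ, hδ, h⟩ := Metric.continuousAt_iff.1 hg.continuousAt ε hε
  filter_upwards [Ioo_mem_nhdsGT hδ] with δ' hδ' t ht
  exact (h (ht.trans hδ'.2)).le

/-- The pairing of `g''` with a compactly supported broken line of height at most `1`. -/
lemma sum_mul_jump_le_TV2 {q : ℕ → ℝ} (hq : StrictMono q) {g : ℝ → ℝ} (hg : g ∈ BV2)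
    {z : ℕ → ℝ} (hz : ∀ i, |z i| ≤ 1) (h0 : z 0 = 0) (h1 : z 1 = 0) {n : ℕ}
    (hn : z n = 0) (hn' : z (n + 1) = 0) :
    ∑ i ∈ Finset.range n, z (i + 1) * (divDiff q (g ∘ q) (i + 1) - divDiff q (g ∘ q) i) ≤
      (TV2 g).toReal := by
  set c : ℕ → ℝ := fun i => divDiff q z (i + 1) - divDiff q z i with hc
  set T := (TV2 g).toReal with hT
  set C := ∑ i ∈ Finset.range n, |c i| with hC
  have hC0 : 0 ≤ C := Finset.sum_nonneg fun _ _ => abs_nonneg _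
  have hT0 : 0 ≤ T := ENNReal.toReal_nonneg
  have hparts := sum_jump_mul_comm hq z (g ∘ q) n
  have hd0 : divDiff q z 0 = 0 := by simp [divDiff, h0, h1]
  have hdn : divDiff q z n = 0 := by simp [divDiff, hn, hn']
  rw [hd0, hdn, h0, hn] at hparts
  simp only [zero_mul, sub_self, add_zero] at hparts
  rw [← hparts]
  have hint : ∀ t, interp q z n t = ∑ i ∈ Finset.range n, c i * relu (t - q (i + 1)) := fun t => by
    simp [interp, h0, hd0, hc]
  have hend : ∀ t, q n ≤ t → ∑ i ∈ Finset.range n, c i * (t - q (i + 1)) = 0 := fun t ht => by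
    rw [← interp_eq_zero_of_ge hq hn hn' ht, hint]
    refine Finset.sum_congr rfl fun i hi => ?_
    have : q (i + 1) ≤ q n := hq.monotone (Finset.mem_range.1 hi)
    rw [relu_of_nonneg (by linarith)]
  have hsum0 : ∑ i ∈ Finset.range n, c i = 0 := by
    have e1 := hend (q n) le_rfl
    have e2 := hend (q n + 1) (by linarith)
    rw [← sub_eq_zero.2 (e2.trans e1.symm), ← Finset.sum_sub_distrib]
    exact Finset.sum_congr rfl fun i _ => by ring
  have key : ∀ ε > 0, ∑ i ∈ Finset.range n, c i * g (q (i + 1)) ≤ T + ε * (2 * C * T + C) := by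
    intro ε hε
    have hev : ∀ᶠ δ in nhdsWithin (0 : ℝ) (Ioi 0), ∀ i ∈ Finset.range n,
        ∀ t, |t - q (i + 1)| < δ → |g t - g (q (i + 1))| ≤ ε :=
      (Finset.eventually_all _).2 fun i _ => eventually_osc_le hg.1 hε _
    obtain ⟨δ, hosc, hδ0, hδε⟩ := (hev.and (Ioo_mem_nhdsGT hε)).exists
    obtain ⟨R, ρ, hRs, hRρ, hρc, hρ0, hρz, hρ1, hRl, ⟨r, hRr⟩, hRn⟩ := exists_smooth_relu hδ0
    set ψ : ℝ → ℝ := fun t => ∑ i ∈ Finset.range n, c i * R (t - q (i + 1)) with hψ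
    have hterm : ∀ i, ContDiff ℝ ∞ fun t => c i * R (t - q (i + 1)) := fun i =>
      contDiff_const.mul (hRs.comp (contDiff_id.sub contDiff_const))
    have hψs : ContDiff ℝ ∞ ψ := ContDiff.sum fun i _ => hterm i
    have hψd : ∀ t, iteratedDeriv 2 ψ t = ∑ i ∈ Finset.range n, c i * ρ (t - q (i + 1)) := fun t => by
      rw [hψ, iteratedDeriv_fun_sum fun i _ => ((hterm i).of_le (by
        exact WithTop.coe_le_coe.2 le_top)).contDiffAt]
      refine Finset.sum_congr rfl fun i _ => ?_
      rw [iteratedDeriv_const_mul_field, iteratedDeriv_comp_sub_const, hRρ]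
    have hψc : HasCompactSupport ψ := by
      refine HasCompactSupport.intro (isCompact_Icc (a := q 0 - δ) (b := q n + δ)) fun t ht => ?_
      rw [mem_Icc, not_and_or, not_le, not_le] at ht
      rcases ht with ht | ht
      · refine Finset.sum_eq_zero fun i _ => ?_
        have : q 0 ≤ q (i + 1) := hq.monotone (Nat.zero_le _)
        rw [hRl _ (by linarith), mul_zero]
      · have e : ψ t = ∑ i ∈ Finset.range n, c i * (t - q (i + 1)) +
            (∑ i ∈ Finset.range n, c i) * r := by
          rw [hψ, Finset.sum_mul, ← Finset.sum_add_distrib]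
          refine Finset.sum_congr rfl fun i hi => ?_
          have : q (i + 1) ≤ q n := hq.monotone (Finset.mem_range.1 hi)
          rw [hRr _ (by linarith)]
          ring
        rw [e, hend t (by linarith), hsum0]
        ring
    have hψb : ∀ t, |ψ t| ≤ 1 + 2 * δ * C := fun t => by
      have e1 : |interp q z n t| ≤ 1 := by
        rcases le_total t (q (n + 1)) with h | h
        · exact abs_interp_le_one hq hz h0 h1 h
        · rw [interp_eq_zero_of_ge hq hn hn' ((hq (Nat.lt_succ_self n)).le.trans h)]
          simp
      have e2 : |ψ t - interp q z n t| ≤ 2 * δ * C := by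
        rw [hint, hψ, ← Finset.sum_sub_distrib, hC, Finset.mul_sum]
        refine (Finset.abs_sum_le_sum_abs _ _).trans (Finset.sum_le_sum fun i _ => ?_)
        rw [← mul_sub, abs_mul, mul_comm]
        exact mul_le_mul_of_nonneg_right (hRn _) (abs_nonneg _)
      have := abs_sub_abs_le_abs_sub (ψ t) (interp q z n t)
      linarith
    have hle := integral_le_mul_TV2 hg.2 hψs hψc hψb
    have hav : ∀ i ∈ Finset.range n, Integrable (fun t => g t * ρ (t - q (i + 1))) ∧
        |(∫ t, g t * ρ (t - q (i + 1))) - g (q (i + 1))| ≤ ε := fun i hi =>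
      abs_integral_mul_sub_le hg.1 hρc hρ0 hρz hρ1 (hosc i hi)
    have hI : ∫ t, g t * iteratedDeriv 2 ψ t =
        ∑ i ∈ Finset.range n, c i * ∫ t, g t * ρ (t - q (i + 1)) := by
      simp_rw [hψd, Finset.mul_sum, mul_left_comm (g _)]
      rw [integral_finsetSum _ fun i hi => (hav i hi).1.const_mul _]
      simp_rw [integral_const_mul]
    have hclose : ∑ i ∈ Finset.range n, c i * g (q (i + 1)) -
        ∑ i ∈ Finset.range n, c i * ∫ t, g t * ρ (t - q (i + 1)) ≤ ε * C := by
      rw [← Finset.sum_sub_distrib, hC, Finset.mul_sum]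
      refine Finset.sum_le_sum fun i hi => ?_
      rw [← mul_sub]
      refine (le_abs_self _).trans ?_
      rw [abs_mul, mul_comm, abs_sub_comm]
      exact mul_le_mul_of_nonneg_right (hav i hi).2 (abs_nonneg _)
    rw [hI] at hle
    have h3 : (1 + 2 * δ * C) * T ≤ (1 + 2 * ε * C) * T := by
      refine mul_le_mul_of_nonneg_right ?_ hT0
      have := mul_le_mul_of_nonneg_right hδε.le hC0
      linarith
    linarith
  have hlim : Tendsto (fun ε : ℝ => T + ε * (2 * C * T + C)) (nhdsWithin 0 (Ioi 0)) (nhds T) := by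
    have : Continuous fun ε : ℝ => T + ε * (2 * C * T + C) := by fun_prop
    simpa using (this.tendsto 0).mono_left nhdsWithin_le_nhds
  exact ge_of_tendsto hlim (eventually_mem_nhdsWithin.mono key)

/-- Piecewise linear interpolation does not increase the second-order total variation. -/
lemma slopeVar_le_TV2 {q : ℕ → ℝ} (hq : StrictMono q) {g : ℝ → ℝ} (hg : g ∈ BV2) (n : ℕ) :
    slopeVar q (g ∘ q) n ≤ (TV2 g).toReal := by
  let q' : ℕ → ℝ := fun i => Nat.casesOn i (q 0 - 1) q
  have hq' : StrictMono q' := strictMono_nat_of_lt_succ fun i => by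
    cases i with
    | zero => exact sub_one_lt (q 0)
    | succ i => exact hq (Nat.lt_succ_self i)
  set J : ℕ → ℝ := fun i => divDiff q (g ∘ q) (i + 1) - divDiff q (g ∘ q) i with hJ
  let z : ℕ → ℝ := fun i => if 2 ≤ i ∧ i < n + 2 then (SignType.sign (J (i - 2)) : ℝ) else 0
  have hz : ∀ i, |z i| ≤ 1 := fun i => by
    simp only [z]
    split_ifs
    · rcases lt_trichotomy (J (i - 2)) 0 with h | h | h <;> simp [h]
    · simp
  have h := sum_mul_jump_le_TV2 hq' hg hz (n := n + 2) (by simp [z]) (by simp [z]) (by simp [z])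
    (by simp [z])
  rw [Finset.sum_range_succ', Finset.sum_range_succ] at h
  have e1 : z (0 + 1) = 0 := by simp [z]
  have e2 : z (n + 1 + 1) = 0 := by simp [z]
  rw [e1, e2, zero_mul, zero_mul, add_zero, add_zero] at h
  refine le_trans (le_of_eq (Finset.sum_congr rfl fun i hi => ?_)) h
  have e3 : z (i + 1 + 1) = SignType.sign (J i) := by
    have := Finset.mem_range.1 hi
    simp [z, this]
  have e4 : divDiff q' (g ∘ q') (i + 1 + 1) - divDiff q' (g ∘ q') (i + 1) = J i := rfl
  rw [e3, e4, sign_mul_self]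

/-- Every function of `BV2` is interpolated on a finite set by a network which is at least as
regular. -/
lemma exists_net_interp {g : ℝ → ℝ} (hg : g ∈ BV2) {L : ℝ} (hL : 0 ≤ L)
    (hgL : lipConst g ≤ ENNReal.ofReal L) (P : Finset ℝ) :
    ∃ η : Params, lipConst η.net ≤ ENNReal.ofReal L ∧ (∀ t ∈ P, η.net t = g t) ∧
      η.weightDecay ≤ (TV2 g).toReal := by
  obtain ⟨q, hq, hqP⟩ := exists_strictMono_enum P
  refine ⟨interpParams q (g ∘ q) P.card, ?_, fun t ht => ?_, ?_⟩
  · rw [lipConst_le_iff hL] at hgL ⊢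
    rw [interpParams_net]
    exact interp_lipschitz hq fun i _ => abs_divDiff_le hq hgL i
  · rw [← hqP] at ht
    obtain ⟨i, hi, rfl⟩ := Finset.mem_image.1 ht
    rw [interpParams_net]
    exact interp_node hq (by have := Finset.mem_range.1 hi; omega)
  · rw [interpParams_weightDecay]
    exact slopeVar_le_TV2 hq hg _

lemma exists_mem_Icc_node {q : ℕ → ℝ} {n : ℕ} {t : ℝ} (h0 : q 0 ≤ t) (h1 : t ≤ q (n + 1)) :
    ∃ i ≤ n, t ∈ Icc (q i) (q (i + 1)) := by
  induction n with
  | zero => exact ⟨0, le_rfl, h0, h1⟩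
  | succ n ih =>
    rcases le_total t (q (n + 1)) with h | h
    · obtain ⟨i, hi, hit⟩ := ih h
      exact ⟨i, by omega, hit⟩
    · exact ⟨n + 1, le_rfl, h, h1⟩

lemma eq_interp_of_affine_pieces {q : ℕ → ℝ} (hq : StrictMono q) {f : ℝ → ℝ} (hf : Continuous f)
    {n : ℕ} (haff : ∀ i ≤ n, ∃ p r : ℝ, ∀ t ∈ Ioo (q i) (q (i + 1)), f t = p * t + r) {t : ℝ}
    (h0 : q 0 ≤ t) (h1 : t ≤ q (n + 1)) : interp q (f ∘ q) n t = f t := by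
  obtain ⟨i, hi, ht⟩ := exists_mem_Icc_node h0 h1
  obtain ⟨p, r, hpr⟩ := haff i hi
  have hlt := hq (Nat.lt_succ_self i)
  have hcl : ∀ s ∈ Icc (q i) (q (i + 1)), f s = p * s + r := fun s hs => by
    have : EqOn f (fun s => p * s + r) (Ioo (q i) (q (i + 1))) := hpr
    have := this.closure hf (by fun_prop)
    rw [closure_Ioo hlt.ne] at this
    exact this hs
  have hd : divDiff q (f ∘ q) i = p := by
    rw [divDiff, div_eq_iff (sub_ne_zero.2 hlt.ne')]
    simp only [Function.comp_apply]
    rw [hcl _ ⟨le_rfl, hlt.le⟩, hcl _ ⟨hlt.le, le_rfl⟩]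
    ring
  rw [interp_of_mem_Icc hq hi ht, hd, hcl t ht, Function.comp_apply, hcl _ ⟨le_rfl, hlt.le⟩]
  ring

section Optimal

variable {M : ℕ} {E : ℝ → ℝ → ℝ} {x y : Fin M → ℝ} {lam Lbar : ℝ} {f : ℝ → ℝ}

lemma TV2_le_slopeVar (hlam : 0 < lam) (hL : 0 ≤ Lbar) (hf : f ∈ Vhyb E x y lam Lbar)
    {q : ℕ → ℝ} (hq : StrictMono q) {n : ℕ} (hx : ∀ m, ∃ i ≤ n + 1, q i = x m) :
    (TV2 f).toReal ≤ slopeVar q (f ∘ q) n := by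
  obtain ⟨⟨-, hfL⟩, hmin⟩ := hf
  set η := interpParams q (f ∘ q) n with hη
  have hηL : lipConst η.net ≤ ENNReal.ofReal Lbar := by
    rw [lipConst_le_iff hL] at hfL ⊢
    rw [hη, interpParams_net]
    exact interp_lipschitz hq fun i _ => abs_divDiff_le hq hfL i
  have h := hmin η.net (net_mem_BV2 η) hηL
  have hxm : ∀ m, η.net (x m) = f (x m) := fun m => by
    obtain ⟨i, hi, hm⟩ := hx m
    rw [← hm, hη, interpParams_net]
    exact interp_node hq hi
  simp only [hxm] at h
  have h' := le_of_mul_le_mul_left (le_of_add_le_add_left h) hlam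
  refine h'.trans ((TV2_net_toReal_le η).trans_eq ?_)
  rw [hη, interpParams_weightDecay]

lemma interp_eq_of_gt (hlam : 0 < lam) (hL : 0 ≤ Lbar) (hf : f ∈ Vhyb E x y lam Lbar)
    {q : ℕ → ℝ} (hq : StrictMono q) {n : ℕ} (hx : ∀ m, ∃ i ≤ n + 1, q i = x m) {t : ℝ}
    (ht : q (n + 1) < t) : interp q (f ∘ q) n t = f t := by
  obtain ⟨q', hq', hqq, hqt⟩ := exists_strictMono_extend hq ht
  have hdd : ∀ i ≤ n, divDiff q' (f ∘ q') i = divDiff q (f ∘ q) i := fun i hi => by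
    simp only [divDiff, Function.comp_apply]
    rw [hqq i (by omega), hqq (i + 1) (by omega)]
  have h1 := slopeVar_le_TV2 hq' hf.1.1 (n + 1)
  have h2 := TV2_le_slopeVar hlam hL hf hq hx
  have e : slopeVar q' (f ∘ q') (n + 1) = slopeVar q (f ∘ q) n +
      |divDiff q' (f ∘ q') (n + 1) - divDiff q (f ∘ q) n| := by
    rw [slopeVar, Finset.sum_range_succ, hdd n le_rfl, slopeVar]
    congr 1
    refine Finset.sum_congr rfl fun i hi => ?_
    have := Finset.mem_range.1 hi
    rw [hdd i (by omega), hdd (i + 1) (by omega)]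
  have h3 : divDiff q' (f ∘ q') (n + 1) = divDiff q (f ∘ q) n :=
    sub_eq_zero.1 (abs_nonpos_iff.1 (by linarith))
  have h4 := divDiff_mul hq' (f ∘ q') (n + 1)
  simp only [Function.comp_apply] at h4
  rw [h3, hqt, hqq (n + 1) le_rfl] at h4
  have h5 := divDiff_mul hq (f ∘ q) n
  simp only [Function.comp_apply] at h5
  rw [interp_of_ge hq ((hq (Nat.lt_succ_self n)).le.trans ht.le), Function.comp_apply]
  linear_combination h4 + h5

lemma interp_eq_of_lt (hlam : 0 < lam) (hL : 0 ≤ Lbar) (hf : f ∈ Vhyb E x y lam Lbar)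
    {q : ℕ → ℝ} (hq : StrictMono q) {n : ℕ} (hx : ∀ m, ∃ i ≤ n + 1, q i = x m) {t : ℝ}
    (ht : t < q 0) : interp q (f ∘ q) n t = f t := by
  let q' : ℕ → ℝ := fun i => Nat.casesOn i t q
  have hq' : StrictMono q' := strictMono_nat_of_lt_succ fun i => by
    cases i with
    | zero => exact ht
    | succ i => exact hq (Nat.lt_succ_self i)
  have h1 := slopeVar_le_TV2 hq' hf.1.1 (n + 1)
  have h2 := TV2_le_slopeVar hlam hL hf hq hx
  have e : slopeVar q' (f ∘ q') (n + 1) = slopeVar q (f ∘ q) n +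
      |divDiff q (f ∘ q) 0 - divDiff q' (f ∘ q') 0| := Finset.sum_range_succ' _ _
  have h3 : divDiff q (f ∘ q) 0 = divDiff q' (f ∘ q') 0 :=
    sub_eq_zero.1 (abs_nonpos_iff.1 (by linarith))
  have h4 : divDiff q' (f ∘ q') 0 * (q 0 - t) = f (q 0) - f t := divDiff_mul hq' (f ∘ q') 0
  rw [interp_of_le hq (Nat.zero_le n) (ht.le.trans (hq (Nat.lt_succ_self 0)).le), interp_zero, h3,
    Function.comp_apply]
  linear_combination -h4

lemma exists_interp_eq (hlam : 0 < lam) (hL : 0 ≤ Lbar) (hf : f ∈ Vhyb E x y lam Lbar)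
    (hpl : IsCPWL f) : ∃ q : ℕ → ℝ, StrictMono q ∧ ∃ n, interp q (f ∘ q) n = f := by
  classical
  obtain ⟨S, hS, hfc, haff⟩ := hpl
  set B : ℝ := 1 + ∑ m, |x m| with hB
  have hsum0 : 0 ≤ ∑ m, |x m| := Finset.sum_nonneg fun _ _ => abs_nonneg _
  have hxB : ∀ m, x m ∈ Icc (-B) B := fun m => by
    have := Finset.single_le_sum (f := fun m => |x m|) (fun _ _ => abs_nonneg _)
      (Finset.mem_univ m)
    rw [mem_Icc, ← abs_le]
    linarith
  set P : Finset ℝ := {-B, B} ∪ (Finset.univ.image x ∪ (hS (-B) B).toFinset) with hP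
  have hPB : ∀ t ∈ P, t ∈ Icc (-B) B := fun t ht => by
    simp only [hP, Finset.mem_union, Finset.mem_insert, Finset.mem_singleton, Finset.mem_image,
      Finset.mem_univ, true_and, Finite.mem_toFinset] at ht
    rcases ht with (rfl | rfl) | ⟨m, rfl⟩ | ht
    · constructor <;> linarith
    · constructor <;> linarith
    · exact hxB m
    · exact ht.2
  have hmB : -B ∈ P := by simp [hP]
  have hpB : B ∈ P := by simp [hP]
  have hcard : 2 ≤ P.card := Finset.one_lt_card.2 ⟨-B, hmB, B, hpB, by linarith⟩
  obtain ⟨q, hq, hqP⟩ := exists_strictMono_enum P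
  obtain ⟨n, hn⟩ : ∃ n, P.card = n + 2 := ⟨P.card - 2, by omega⟩
  rw [hn] at hqP
  have hmem : ∀ t ∈ P, ∃ i ≤ n + 1, q i = t := fun t ht => by
    rw [← hqP] at ht
    obtain ⟨i, hi, h⟩ := Finset.mem_image.1 ht
    exact ⟨i, by have := Finset.mem_range.1 hi; omega, h⟩
  have hqmem : ∀ i ≤ n + 1, q i ∈ P := fun i hi => by
    rw [← hqP]; exact Finset.mem_image_of_mem q (Finset.mem_range.2 (by omega))
  have hx' : ∀ m, ∃ i ≤ n + 1, q i = x m := fun m => hmem _ (by simp [hP])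
  refine ⟨q, hq, n, funext fun t => ?_⟩
  rcases lt_or_ge t (q 0) with h0 | h0
  · exact interp_eq_of_lt hlam hL hf hq hx' h0
  rcases lt_or_ge (q (n + 1)) t with h1 | h1
  · exact interp_eq_of_gt hlam hL hf hq hx' h1
  refine eq_interp_of_affine_pieces hq hfc (fun i hi => ?_) h0 h1
  refine haff _ _ (hq (Nat.lt_succ_self i)) (disjoint_left.2 fun s hs hsS => ?_)
  have hsP : s ∈ P := by
    have hsB : s ∈ Icc (-B) B :=
      ⟨(hPB _ (hqmem i (by omega))).1.trans hs.1.le,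
        hs.2.le.trans (hPB _ (hqmem (i + 1) (by omega))).2⟩
    simp [hP, hsS, hsB.1, hsB.2]
  obtain ⟨j, -, rfl⟩ := hmem s hsP
  have := hq.lt_iff_lt.1 hs.1
  have := hq.lt_iff_lt.1 hs.2
  omega

lemma exists_net_objective_le (hlam : 0 < lam) (hL : 0 ≤ Lbar) {g : ℝ → ℝ} (hg : g ∈ BV2)
    (hgL : lipConst g ≤ ENNReal.ofReal Lbar) :
    ∃ η : Params, lipConst η.net ≤ ENNReal.ofReal Lbar ∧ (∀ m, η.net (x m) = g (x m)) ∧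
      lam * η.weightDecay ≤ lam * (TV2 g).toReal := by
  classical
  obtain ⟨η, h1, h2, h3⟩ := exists_net_interp hg hL hgL (Finset.univ.image x)
  exact ⟨η, h1, fun m => h2 _ (by simp), mul_le_mul_of_nonneg_left h3 hlam.le⟩

lemma net_mem_Vhyb (hlam : 0 < lam) (hL : 0 ≤ Lbar) {θ : Params} (hθ : θ ∈ VNN E x y lam Lbar) :
    θ.net ∈ Vhyb E x y lam Lbar := by
  refine ⟨⟨net_mem_BV2 θ, hθ.1⟩, fun g hg hgL => ?_⟩
  obtain ⟨η, hη, hηx, hηR⟩ := exists_net_objective_le (x := x) hlam hL hg hgL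
  have h1 := hθ.2 η hη
  simp only [hηx] at h1
  have h2 := mul_le_mul_of_nonneg_left (TV2_net_toReal_le θ) hlam.le
  linarith

lemma abs_weights_eq (hlam : 0 < lam) (hL : 0 ≤ Lbar) {θ : Params} (hθ : θ ∈ VNN E x y lam Lbar)
    (k : Fin θ.K) : |θ.v k| = |θ.w k| := by
  obtain ⟨η, hη, hηx, hηR⟩ := exists_net_objective_le (x := x) hlam hL (net_mem_BV2 θ) hθ.1
  have h1 := hθ.2 η hη
  simp only [hηx] at h1
  have h2 : θ.weightDecay ≤ (TV2 θ.net).toReal :=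
    le_of_mul_le_mul_left ((le_of_add_le_add_left h1).trans hηR) hlam
  have h3 : (TV2 θ.net).toReal ≤ ∑ k, |θ.v k| * |θ.w k| :=
    ENNReal.toReal_le_of_le_ofReal
      (Finset.sum_nonneg fun _ _ => mul_nonneg (abs_nonneg _) (abs_nonneg _)) (TV2_net_le θ)
  have h4 : ∑ k, (|θ.v k| - |θ.w k|) ^ 2 / 2 = 0 := by
    refine le_antisymm ?_ (Finset.sum_nonneg fun _ _ => by positivity)
    have e : ∑ k, (|θ.v k| - |θ.w k|) ^ 2 / 2 =
        θ.weightDecay - ∑ k, |θ.v k| * |θ.w k| := by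
      rw [Params.weightDecay, ← Finset.sum_sub_distrib]
      exact Finset.sum_congr rfl fun _ _ => by ring
    rw [e]; linarith
  have h5 := (Finset.sum_eq_zero_iff_of_nonneg fun _ _ => by positivity).1 h4 k (Finset.mem_univ k)
  have h6 : (|θ.v k| - |θ.w k|) ^ 2 = 0 := by linarith
  exact sub_eq_zero.1 (pow_eq_zero_iff two_ne_zero |>.1 h6)

lemma exists_mem_VNN (hlam : 0 < lam) (hL : 0 ≤ Lbar) (hf : f ∈ Vhyb E x y lam Lbar)
    (hpl : IsCPWL f) : ∃ θ ∈ VNN E x y lam Lbar, θ.net = f := by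
  obtain ⟨q, hq, n, hqf⟩ := exists_interp_eq hlam hL hf hpl
  have hnet : (interpParams q (f ∘ q) n).net = f := (interpParams_net _ _ _).trans hqf
  refine ⟨interpParams q (f ∘ q) n, ⟨by rw [hnet]; exact hf.1.2, fun η hη => ?_⟩, hnet⟩
  have h1 := hf.2 η.net (net_mem_BV2 η) hη
  have h2 := mul_le_mul_of_nonneg_left (TV2_net_toReal_le η) hlam.le
  have h3 := mul_le_mul_of_nonneg_left (slopeVar_le_TV2 hq hf.1.1 n) hlam.le
  rw [hnet, interpParams_weightDecay]
  linarith

end Optimal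

end LipReLU

theorem proposition1 (M : ℕ) (x y : Fin M → ℝ) (hx : StrictMono x)
    (E : ℝ → ℝ → ℝ)
    (hE_convex : ∀ s : ℝ, StrictConvexOn ℝ Set.univ (fun z : ℝ => E z s))
    (hE_coercive : ∀ s : ℝ,
      Filter.Tendsto (fun z : ℝ => E z s) (Filter.cocompact ℝ) Filter.atTop)
    (lam Lbar : ℝ) (hlam : 0 < lam) (hLbar : 0 < Lbar) :
    (∀ θ ∈ LipReLU.VNN E x y lam Lbar,
      θ.net ∈ LipReLU.Vhyb E x y lam Lbar ∧ LipReLU.IsFiniteCPWL θ.net ∧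
        ∀ k, |θ.v k| = |θ.w k|) ∧
    (∀ f ∈ LipReLU.Vhyb E x y lam Lbar, LipReLU.IsCPWL f →
      ∃ θ ∈ LipReLU.VNN E x y lam Lbar, θ.net = f) :=
  ⟨fun θ hθ => ⟨LipReLU.net_mem_Vhyb hlam hLbar.le hθ, LipReLU.isFiniteCPWL_net θ,
      LipReLU.abs_weights_eq hlam hLbar.le hθ⟩,
    fun _ hf hpl => LipReLU.exists_mem_VNN hlam hLbar.le hf hpl⟩
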